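/- Let $X$ and $Y$ be paracompact Hausdorff spaces. For an open cover $\mathcal W$ of $X\times Y$, the rectangular-cover game $G(X,Y,\mathcal W)$ is played as follows by Players I and II. Put $U_{-1}=X$ and $V_{-1}=Y$. At move $n\ge 0$, Player I chooses an open cover $\mathcal U_n$ of $U_{n-1}$ and an open cover $\mathcal V_n$ of $V_{n-1}$, obtained by restricting open covers of $X$ and of $Y$ to $U_{n-1}$ and $V_{n-1}$ respectively; then Player II selects, if possible, $U_n\in\mathcal U_n$ and $V_n\in\mathcal V_n$ such that $U_n\times V_n$ is contained in no member of $\mathcal W$. If Player II has no such selection, the play stops. Player I wins the play if it has only finitely many moves; otherwise Player II wins. Let $T(X)\times_{\mathrm{loc}}T(Y)$ be the product, in the category of locales, of the topologies $T(X)$ and $T(Y)$ (that is, their coproduct in the category of frames). A locale $L$ is called spatial if any two distinct elements of $L$ are distinguished by a point, i.e. by a frame homomorphism from $L$ to the two-element frame. Then $T(X)\times_{\mathrm{loc}}T(Y)$ is spatial if and only if, for every open cover $\mathcal W$ of $X\times Y$, Player I has a winning strategy in the game $G(X,Y,\mathcal W)$. -/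

import Mathlib

open TopologicalSpace

universe u v w

/-! ### The coproduct of two frames (the product of two locales) -/

/-- An element of the coproduct `A ⨿ B` of the frames `A` and `B`: a set of formal rectangles
`(a, b)` that is closed downwards and under arbitrary joins (the empty one included) in each
coordinate, the other coordinate being fixed. These are the sets of rectangles saturated for the
covering relation generated by splitting one coordinate at a time. -/
@[ext]
structure FrameCoprod (A : Type u) (B : Type v) [Order.Frame A] [Order.Frame B] where
  /-- The rectangles that belong to the element. -/
  carrier : Set (A × B)
  lower' : IsLowerSet carrier
  sSup_left' : ∀ (S : Set A) (b : B), (∀ a ∈ S, (a, b) ∈ carrier) → (sSup S, b) ∈ carrier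
  sSup_right' : ∀ (a : A) (T : Set B), (∀ b ∈ T, (a, b) ∈ carrier) → (a, sSup T) ∈ carrier

namespace FrameCoprod

variable {A : Type u} {B : Type v} [Order.Frame A] [Order.Frame B]

/-- The order of the coproduct is inclusion. -/
instance : PartialOrder (FrameCoprod A B) :=
  PartialOrder.lift FrameCoprod.carrier (fun _ _ h => FrameCoprod.ext h)

theorem le_def {I J : FrameCoprod A B} : I ≤ J ↔ I.carrier ⊆ J.carrier := Iff.rfl

instance : InfSet (FrameCoprod A B) where
  sInf 𝒮 :=
    { carrier := {p | ∀ I ∈ 𝒮, p ∈ I.carrier}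
      lower' := fun _ _ hqp hp I hI => I.lower' hqp (hp I hI)
      sSup_left' := fun S b h I hI => I.sSup_left' S b fun a ha => h a ha I hI
      sSup_right' := fun a T h I hI => I.sSup_right' a T fun b hb => h b hb I hI }

instance : Min (FrameCoprod A B) where
  min I J :=
    { carrier := I.carrier ∩ J.carrier
      lower' := I.lower'.inter J.lower'
      sSup_left' := fun S b h =>
        ⟨I.sSup_left' S b fun a ha => (h a ha).1, J.sSup_left' S b fun a ha => (h a ha).2⟩
      sSup_right' := fun a T h =>
        ⟨I.sSup_right' a T fun b hb => (h b hb).1, J.sSup_right' a T fun b hb => (h b hb).2⟩ }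

instance : Top (FrameCoprod A B) where
  top :=
    { carrier := Set.univ
      lower' := isLowerSet_univ
      sSup_left' := fun _ _ _ => Set.mem_univ _
      sSup_right' := fun _ _ _ => Set.mem_univ _ }

instance : CompleteLattice (FrameCoprod A B) :=
  { completeLatticeOfInf (FrameCoprod A B) (fun _ =>
      ⟨fun I hI _ hp => hp I hI, fun _ hJ _ hp _ hI => hJ hI hp⟩) with
    inf := fun I J => I ⊓ J
    inf_le_left := fun _ _ _ hp => hp.1
    inf_le_right := fun _ _ _ hp => hp.2
    le_inf := fun _ _ _ h₁ h₂ _ hp => ⟨h₁ hp, h₂ hp⟩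
    top := ⊤
    le_top := fun _ _ _ => Set.mem_univ _ }

/-- The element of all rectangles whose meet with every rectangle of `I` lies in `K`. -/
def residual (I K : FrameCoprod A B) : FrameCoprod A B where
  carrier := {p | ∀ q ∈ I.carrier, p ⊓ q ∈ K.carrier}
  lower' := fun _ _ hqp hp r hr => K.lower' (inf_le_inf_right r hqp) (hp r hr)
  sSup_left' := fun S b h q hq => by
    have : (sSup S, b) ⊓ q = (sSup ((fun a => a ⊓ q.1) '' S), b ⊓ q.2) := by
      rw [sSup_image, ← sSup_inf_eq]; rfl
    rw [this]
    refine K.sSup_left' _ _ ?_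
    rintro _ ⟨a, ha, rfl⟩
    exact h a ha q hq
  sSup_right' := fun a T h q hq => by
    have : (a, sSup T) ⊓ q = (a ⊓ q.1, sSup ((fun b => b ⊓ q.2) '' T)) := by
      rw [sSup_image, ← sSup_inf_eq]; rfl
    rw [this]
    refine K.sSup_right' _ _ ?_
    rintro _ ⟨b, hb, rfl⟩
    exact h b hb q hq

/-- The coproduct is a frame. -/
instance : Order.Frame (FrameCoprod A B) :=
  Order.Frame.ofMinimalAxioms
    { (inferInstance : CompleteLattice (FrameCoprod A B)) with
      inf_sSup_le_iSup_inf := fun I 𝒮 => by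
        have h : sSup 𝒮 ≤ residual I (⨆ J ∈ 𝒮, I ⊓ J) := by
          refine sSup_le fun J hJ p hp q hq => ?_
          have hle : I ⊓ J ≤ ⨆ J ∈ 𝒮, I ⊓ J := le_iSup₂_of_le J hJ le_rfl
          exact hle ⟨I.lower' inf_le_right hq, J.lower' inf_le_left hp⟩
        intro p hp
        have := h hp.2 p hp.1
        rwa [inf_idem] at this }

theorem bot_left_mem (I : FrameCoprod A B) (b : B) : (⊥, b) ∈ I.carrier := by
  simpa using I.sSup_left' ∅ b (by simp)

theorem bot_right_mem (I : FrameCoprod A B) (a : A) : (a, ⊥) ∈ I.carrier := by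
  simpa using I.sSup_right' a ∅ (by simp)

/-- The insertion of the first frame. -/
def inl : FrameHom A (FrameCoprod A B) where
  toFun a :=
    { carrier := {p | p.1 ≤ a ∨ p.2 = ⊥}
      lower' := fun _ _ hqp hp =>
        hp.imp (fun h => hqp.1.trans h) (fun h => le_bot_iff.1 (hqp.2.trans h.le))
      sSup_left' := fun S b h => by
        by_cases hb : b = ⊥
        · exact Or.inr hb
        · exact Or.inl (sSup_le fun x hx => (h x hx).resolve_right hb)
      sSup_right' := fun x T h => by
        by_cases hx : x ≤ a
        · exact Or.inl hx
        · exact Or.inr (sSup_eq_bot.2 fun b hb => (h b hb).resolve_left hx) }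
  map_inf' a a' := by
    ext p
    change (p.1 ≤ a ⊓ a' ∨ p.2 = ⊥) ↔ (p.1 ≤ a ∨ p.2 = ⊥) ∧ (p.1 ≤ a' ∨ p.2 = ⊥)
    rw [le_inf_iff]; tauto
  map_top' := by
    ext p
    exact ⟨fun _ => Set.mem_univ _, fun _ => Or.inl le_top⟩
  map_sSup' S := by
    refine le_antisymm ?_ (sSup_le ?_)
    · rintro ⟨x, y⟩ (hx | rfl)
      · refine lower' _ (⟨hx, le_top⟩ : (x, y) ≤ (sSup S, (⊤ : B))) (sSup_left' _ _ _ fun a ha => ?_)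
        exact le_def.1 (le_sSup (Set.mem_image_of_mem _ ha)) (Or.inl le_rfl)
      · exact bot_right_mem _ _
    · rintro _ ⟨a, ha, rfl⟩ p hp
      exact hp.imp (fun h => h.trans (le_sSup ha)) id

/-- The insertion of the second frame. -/
def inr : FrameHom B (FrameCoprod A B) where
  toFun b :=
    { carrier := {p | p.1 = ⊥ ∨ p.2 ≤ b}
      lower' := fun _ _ hqp hp =>
        hp.imp (fun h => le_bot_iff.1 (hqp.1.trans h.le)) (fun h => hqp.2.trans h)
      sSup_left' := fun S y h => by
        by_cases hy : y ≤ b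
        · exact Or.inr hy
        · exact Or.inl (sSup_eq_bot.2 fun x hx => (h x hx).resolve_right hy)
      sSup_right' := fun x T h => by
        by_cases hx : x = ⊥
        · exact Or.inl hx
        · exact Or.inr (sSup_le fun y hy => (h y hy).resolve_left hx) }
  map_inf' b b' := by
    ext p
    change (p.1 = ⊥ ∨ p.2 ≤ b ⊓ b') ↔ (p.1 = ⊥ ∨ p.2 ≤ b) ∧ (p.1 = ⊥ ∨ p.2 ≤ b')
    rw [le_inf_iff]; tauto
  map_top' := by
    ext p
    exact ⟨fun _ => Set.mem_univ _, fun _ => Or.inr le_top⟩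
  map_sSup' T := by
    refine le_antisymm ?_ (sSup_le ?_)
    · rintro ⟨x, y⟩ (rfl | hy)
      · exact bot_left_mem _ _
      · refine lower' _ (⟨le_top, hy⟩ : (x, y) ≤ ((⊤ : A), sSup T))
          (sSup_right' _ _ _ fun b hb => ?_)
        exact le_def.1 (le_sSup (Set.mem_image_of_mem _ hb)) (Or.inr le_rfl)
    · rintro _ ⟨b, hb, rfl⟩ p hp
      exact hp.imp id (fun h => h.trans (le_sSup hb))

theorem inl_inf_inr_le {I : FrameCoprod A B} {p : A × B} (hp : p ∈ I.carrier) :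
    inl p.1 ⊓ inr p.2 ≤ I := by
  rintro ⟨x, y⟩ ⟨h₁, h₂⟩
  rcases h₁ with h₁ | rfl
  · rcases h₂ with rfl | h₂
    · exact bot_left_mem _ _
    · exact I.lower' (⟨h₁, h₂⟩ : (x, y) ≤ p) hp
  · exact bot_right_mem _ _

theorem eq_iSup (I : FrameCoprod A B) : I = ⨆ p ∈ I.carrier, inl p.1 ⊓ inr p.2 := by
  refine le_antisymm (fun p hp => ?_) (iSup₂_le fun p hp => inl_inf_inr_le hp)
  have h : inl p.1 ⊓ inr p.2 ≤ ⨆ p ∈ I.carrier, inl p.1 ⊓ inr p.2 :=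
    le_iSup₂_of_le p hp le_rfl
  exact h ⟨Or.inl le_rfl, Or.inr le_rfl⟩

/-- The universal property: `FrameCoprod A B` with its two insertions is the coproduct of `A` and
`B` in the category of frames, hence their product in the category of locales. -/
theorem existsUnique_desc {C : Type w} [Order.Frame C] (f : FrameHom A C) (g : FrameHom B C) :
    ∃! h : FrameHom (FrameCoprod A B) C, h.comp inl = f ∧ h.comp inr = g := by
  let e : FrameCoprod A B → C := fun I => ⨆ p ∈ I.carrier, f p.1 ⊓ g p.2
  let r : C → FrameCoprod A B := fun c =>
    { carrier := {p | f p.1 ⊓ g p.2 ≤ c}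
      lower' := fun p q hqp (hp : f p.1 ⊓ g p.2 ≤ c) =>
        (inf_le_inf (OrderHomClass.mono f hqp.1) (OrderHomClass.mono g hqp.2)).trans hp
      sSup_left' := fun S b h => by
        change f (sSup S) ⊓ g b ≤ c
        rw [map_sSup, sSup_image, iSup₂_inf_eq]
        exact iSup₂_le h
      sSup_right' := fun a T h => by
        change f a ⊓ g (sSup T) ≤ c
        rw [map_sSup, sSup_image, inf_iSup₂_eq]
        exact iSup₂_le h }
  have gc : GaloisConnection e r := fun I c => by
    simp only [e, iSup_le_iff]
    exact ⟨fun h p hp => h p hp, fun h p hp => h hp⟩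
  let h : FrameHom (FrameCoprod A B) C :=
    { toFun := e
      map_inf' := fun I J => by
        refine le_antisymm (gc.monotone_l.map_inf_le I J) ?_
        simp only [e, iSup₂_inf_eq, inf_iSup₂_eq]
        refine iSup₂_le fun q hq => iSup₂_le fun p hp => ?_
        refine le_iSup₂_of_le (p ⊓ q)
          ⟨I.lower' inf_le_left hp, J.lower' inf_le_right hq⟩ ?_
        simp only [Prod.fst_inf, Prod.snd_inf, map_inf]
        rw [inf_inf_inf_comm]
      map_top' := top_unique
        (le_iSup₂_of_le ((⊤ : A), (⊤ : B)) (Set.mem_univ _) (by simp))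
      map_sSup' := fun 𝒮 => by rw [gc.l_sSup, sSup_image] }
  refine ⟨h, ⟨?_, ?_⟩, ?_⟩
  · ext a
    refine le_antisymm (iSup₂_le ?_) (le_iSup₂_of_le (a, (⊤ : B)) (Or.inl le_rfl) (by simp))
    rintro ⟨x, y⟩ (hx | hy)
    · exact inf_le_left.trans (OrderHomClass.mono f hx)
    · have hy : y = ⊥ := hy
      simp [hy]
  · ext b
    refine le_antisymm (iSup₂_le ?_) (le_iSup₂_of_le ((⊤ : A), b) (Or.inr le_rfl) (by simp))
    rintro ⟨x, y⟩ (hx | hy)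
    · have hx : x = ⊥ := hx
      simp [hx]
    · exact inf_le_right.trans (OrderHomClass.mono g hy)
  · rintro k ⟨rfl, rfl⟩
    ext I
    conv_lhs => rw [eq_iSup I]
    simp only [map_iSup, map_inf]
    rfl

end FrameCoprod

/-- The localic product `T(X) ×_loc T(Y)` of the topologies of `X` and `Y`, given by its frame. -/
abbrev LocalicProduct (X : Type u) (Y : Type v) [TopologicalSpace X] [TopologicalSpace Y] :
    Type (max u v) :=
  FrameCoprod (Opens X) (Opens Y)

/-- A locale is spatial if its distinct elements are distinguished by points, a point being a
frame homomorphism to the two-element frame. -/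
def IsSpatialLocale (L : Type u) [Order.Frame L] : Prop :=
  ∀ x y : L, x ≠ y → ∃ φ : FrameHom L Prop, φ x ≠ φ y

/-! ### The rectangular-cover game -/

/-- An open cover of a space. -/
structure OpenCover (X : Type u) [TopologicalSpace X] where
  /-- The members of the cover. -/
  members : Set (Opens X)
  covers : ∀ x : X, ∃ U ∈ members, x ∈ U

namespace RectGame

variable {X : Type u} {Y : Type v} [TopologicalSpace X] [TopologicalSpace Y]

/-- An open rectangle `U × V`, given by its sides. -/
abbrev Rect (X : Type u) (Y : Type v) [TopologicalSpace X] [TopologicalSpace Y] : Type (max u v) :=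
  Opens X × Opens Y

/-- The restriction `{U ∩ G : G ∈ 𝒢}` of an open cover `𝒢` of `X` to an open set `U`. -/
def restrict (𝒢 : OpenCover X) (U : Opens X) : Set (Opens X) :=
  {P | ∃ G ∈ 𝒢.members, P = U ⊓ G}

/-- A strategy of Player I: given the list of the rectangles that Player II has selected so far
(the last one first), it names an open cover of `X` and one of `Y`; Player I then plays their
restrictions to the sides of the current rectangle. -/
abbrev Strategy (X : Type u) (Y : Type v) [TopologicalSpace X] [TopologicalSpace Y] :
    Type (max u v) :=
  List (Rect X Y) → OpenCover X × OpenCover Y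

/-- The current rectangle: the last selection of Player II, and `X × Y` at the start. -/
def current (h : List (Rect X Y)) : Rect X Y := h.headD (⊤, ⊤)

/-- The selections open to Player II in the game for the cover `𝒲`, after the selections `h` and
the answer of Player I to them by `σ`: the rectangles `U × V`, with `U` and `V` in the covers
just played, that are contained in no member of `𝒲`. -/
def legalMoves (𝒲 : OpenCover (X × Y)) (σ : Strategy X Y) (h : List (Rect X Y)) :
    Set (Rect X Y) :=
  {R | R.1 ∈ restrict (σ h).1 (current h).1 ∧ R.2 ∈ restrict (σ h).2 (current h).2 ∧
    ∀ W ∈ 𝒲.members, ¬ (R.1 : Set X) ×ˢ (R.2 : Set Y) ⊆ (W : Set (X × Y))}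

/-- The first `n` selections of the sequence `r`, the last one first. -/
def history (r : ℕ → Rect X Y) : ℕ → List (Rect X Y)
  | 0 => []
  | n + 1 => r n :: history r n

/-- The strategy `σ` of Player I wins the game for `𝒲`: no play that follows `σ` has
infinitely many moves. -/
def Strategy.IsWinning (σ : Strategy X Y) (𝒲 : OpenCover (X × Y)) : Prop :=
  ¬ ∃ r : ℕ → Rect X Y, ∀ n, r n ∈ legalMoves 𝒲 σ (history r n)

/-- Player I has a winning strategy in the game `G(X, Y, 𝒲)`. -/
def PlayerIWins (𝒲 : OpenCover (X × Y)) : Prop :=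
  ∃ σ : Strategy X Y, σ.IsWinning 𝒲

end RectGame

/-! Since Hausdorff spaces are sober, the points of the localic product are the pairs $(x,y)$.
Spatiality therefore says that an element contains every rectangle that its own rectangles cover
pointwise. If Player I wins every game, a rectangle outside such an element would let Player II stay
outside forever, because elements are closed under joins in each coordinate
(`top_mem_of_playerIWins`, localized in `mem_of_playerIWins`). Conversely, the rectangles from which
Player I wins, after shrinking by closures, form an element (`winningElement`) containing all
points; spatiality makes it the top. Paracompactness enters through regularity: closures let a cover
of part of a space extend to a cover of the whole space. -/

namespace FrameCoprod

/-! ### Points of the localic product -/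

variable {X : Type u} {Y : Type v} [TopologicalSpace X] [TopologicalSpace Y]

/-- The frame homomorphism to `Prop` given by a point of a space. -/
def pointHom (x : X) : FrameHom (Opens X) Prop where
  toFun U := x ∈ U
  map_inf' _ _ := rfl
  map_top' := by simp
  map_sSup' S := by
    refine propext ?_
    rw [Opens.mem_sSup, sSup_image]
    simp only [iSup_Prop_eq, exists_prop]

/-- In a Hausdorff space every frame homomorphism to `Prop` is given by a point. -/
theorem exists_eq_pointHom [T2Space X] (φ : FrameHom (Opens X) Prop) : ∃ x, φ = pointHom x := by
  -- `N` is the largest open set that `φ` rejects; the point sought is any point outside it.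
  set N : Opens X := sSup {U | ¬ φ U} with hN
  have hφN : ¬ φ N := by
    rw [hN, map_sSup, sSup_image]
    simp only [iSup_Prop_eq, exists_prop, Set.mem_ofPred_eq]
    rintro ⟨U, h, h'⟩
    exact h h'
  have le_N : ∀ U, ¬ φ U → U ≤ N := fun U hU => le_sSup hU
  have hNtop : ∃ x, x ∉ N := by
    by_contra! h
    have : N = ⊤ := by ext x; simpa using h x
    exact hφN (by rw [this, map_top]; trivial)
  obtain ⟨x, hx⟩ := hNtop
  have of_mem : ∀ U : Opens X, x ∈ U → φ U := fun U hxU => by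
    by_contra h
    exact hx (le_N U h hxU)
  refine ⟨x, ?_⟩
  ext U
  refine ⟨fun hU => ?_, of_mem U⟩
  -- If `x ∉ U`, each `y ∈ U` has a neighbourhood disjoint from one of `x`. As `φ` accepts the
  -- latter, it rejects the former, so `U ≤ N` although `φ U` holds.
  by_contra hxU
  refine hφN (OrderHomClass.mono φ (fun y hy => ?_) hU)
  have hxy : x ≠ y := by rintro rfl; exact hxU hy
  obtain ⟨A, B, hA, hB, hxA, hyB, hAB⟩ := t2_separation hxy
  refine le_N ⟨B, hB⟩ (fun h => ?_) hyB
  have hinf : (⟨A, hA⟩ : Opens X) ⊓ ⟨B, hB⟩ = ⊥ := by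
    ext z
    simpa using fun hz hz' => Set.disjoint_left.1 hAB hz hz'
  have : φ ((⟨A, hA⟩ : Opens X) ⊓ ⟨B, hB⟩) := by
    rw [map_inf]
    exact ⟨of_mem _ hxA, h⟩
  rw [hinf, map_bot] at this
  exact this

/-- A point of the product space gives a point of the localic product, which lies in an element
exactly when it lies in one of its rectangles. -/
theorem exists_point (x : X) (y : Y) : ∃ φ : FrameHom (LocalicProduct X Y) Prop,
    ∀ I, φ I ↔ ∃ p ∈ I.carrier, x ∈ p.1 ∧ y ∈ p.2 := by
  obtain ⟨φ, ⟨hl, hr⟩, -⟩ := existsUnique_desc (pointHom x) (pointHom y)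
  have hl' : ∀ U, φ (inl U) = (x ∈ U) := fun U => DFunLike.congr_fun hl U
  have hr' : ∀ V, φ (inr V) = (y ∈ V) := fun V => DFunLike.congr_fun hr V
  refine ⟨φ, fun I => ?_⟩
  conv_lhs => rw [eq_iSup I]
  simp only [map_iSup, map_inf, hl', hr', iSup_Prop_eq, inf_Prop_eq, exists_prop]

/-- In the localic product of Hausdorff spaces, every point lies in some rectangle of an element
whose rectangles cover the product space. -/
theorem map_of_forall_mem [T2Space X] [T2Space Y] (φ : FrameHom (LocalicProduct X Y) Prop)
    {I : LocalicProduct X Y} (hI : ∀ x y, ∃ p ∈ I.carrier, x ∈ p.1 ∧ y ∈ p.2) : φ I := by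
  obtain ⟨x, hx⟩ := exists_eq_pointHom (φ.comp inl)
  obtain ⟨y, hy⟩ := exists_eq_pointHom (φ.comp inr)
  obtain ⟨p, hp, hxp, hyp⟩ := hI x y
  refine OrderHomClass.mono φ (inl_inf_inr_le hp) ?_
  rw [map_inf]
  exact ⟨(DFunLike.congr_fun hx p.1).symm ▸ hxp, (DFunLike.congr_fun hy p.2).symm ▸ hyp⟩

/-- The element of all rectangles whose meet with a fixed rectangle lies in `K`. -/
def rectResidual {A : Type u} {B : Type v} [Order.Frame A] [Order.Frame B] (q : A × B)
    (K : FrameCoprod A B) : FrameCoprod A B where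
  carrier := {p | p ⊓ q ∈ K.carrier}
  lower' := fun _ _ hqp hp => K.lower' (inf_le_inf_right q hqp) hp
  sSup_left' := fun S b h => by
    have : (sSup S, b) ⊓ q = (sSup ((fun a => a ⊓ q.1) '' S), b ⊓ q.2) := by
      rw [sSup_image, ← sSup_inf_eq]; rfl
    rw [Set.mem_ofPred_eq, this]
    refine K.sSup_left' _ _ ?_
    rintro _ ⟨a, ha, rfl⟩
    exact h a ha
  sSup_right' := fun a T h => by
    have : (a, sSup T) ⊓ q = (a ⊓ q.1, sSup ((fun b => b ⊓ q.2) '' T)) := by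
      rw [sSup_image, ← sSup_inf_eq]; rfl
    rw [Set.mem_ofPred_eq, this]
    refine K.sSup_right' _ _ ?_
    rintro _ ⟨b, hb, rfl⟩
    exact h b hb

/-- A rectangle with the same points as part of a rectangle of `I` lies in `I`. -/
theorem mem_of_prod_subset (I : LocalicProduct X Y) {p q : Opens X × Opens Y}
    (hq : q ∈ I.carrier) (h : (p.1 : Set X) ×ˢ (p.2 : Set Y) ⊆ (q.1 : Set X) ×ˢ (q.2 : Set Y)) :
    p ∈ I.carrier := by
  obtain ⟨U, V⟩ := p
  rcases Set.prod_subset_prod_iff.1 h with h | h | h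
  · exact I.lower' (⟨h.1, h.2⟩ : (U, V) ≤ q) hq
  · obtain rfl : U = ⊥ := Opens.ext h
    exact bot_left_mem _ _
  · obtain rfl : V = ⊥ := Opens.ext h
    exact bot_right_mem _ _

end FrameCoprod

/-- In a regular space, an open set is the join of the open sets whose closure it contains. -/
theorem Opens.sSup_closure_subset {X : Type u} [TopologicalSpace X] [RegularSpace X]
    (U : Opens X) : sSup {U' : Opens X | closure (U' : Set X) ⊆ U} = U := by
  refine le_antisymm (sSup_le fun U' h => subset_closure.trans h) fun x hx => ?_
  obtain ⟨G, hG, hxG, hGU⟩ :=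
    TopologicalSpace.IsTopologicalBasis.exists_closure_subset
      (TopologicalSpace.isTopologicalBasis_opens) (U.isOpen.mem_nhds hx)
  exact Opens.mem_sSup.2 ⟨⟨G, hG⟩, hGU, hxG⟩

/-! ### Winning strategies and elements of the localic product -/

namespace RectGame

variable {X : Type u} {Y : Type v} [TopologicalSpace X] [TopologicalSpace Y]

theorem sSup_restrict (𝒢 : OpenCover X) (U : Opens X) : sSup (restrict 𝒢 U) = U := by
  refine le_antisymm (sSup_le ?_) fun x hx => ?_
  · rintro _ ⟨G, -, rfl⟩
    exact inf_le_left
  · obtain ⟨G, hG, hxG⟩ := 𝒢.covers x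
    exact Opens.mem_sSup.2 ⟨U ⊓ G, ⟨G, hG, rfl⟩, hx, hxG⟩

/-- If Player I wins the game for `𝒲`, then an element of the localic product that has all
rectangles contained in members of `𝒲` has all rectangles. -/
theorem top_mem_of_playerIWins {𝒲 : OpenCover (X × Y)} (h : PlayerIWins 𝒲)
    (I : LocalicProduct X Y)
    (hI : ∀ R : Rect X Y, ∀ W ∈ 𝒲.members, (R.1 : Set X) ×ˢ (R.2 : Set Y) ⊆ (W : Set (X × Y)) →
      R ∈ I.carrier) : (⊤, ⊤) ∈ I.carrier := by
  obtain ⟨σ, hσ⟩ := h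
  by_contra htop
  -- Player II can always move outside `I`: a piece that is not a legal move lies in a member of
  -- `𝒲`, hence in `I`, so otherwise all pieces would be in `I` and their joins would rebuild the
  -- current rectangle.
  have step : ∀ l, current l ∉ I.carrier → ∃ R ∈ legalMoves 𝒲 σ l, R ∉ I.carrier := by
    intro l hl
    by_contra! hno
    refine hl ?_
    have key : (sSup (restrict (σ l).1 (current l).1), sSup (restrict (σ l).2 (current l).2)) ∈
        I.carrier := by
      refine I.sSup_left' _ _ fun P hP => I.sSup_right' _ _ fun Q hQ => ?_
      by_contra hPQ
      exact hPQ (hno (P, Q) ⟨hP, hQ, fun W hW hsub => hPQ (hI (P, Q) W hW hsub)⟩)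
    rwa [sSup_restrict, sSup_restrict] at key
  choose! next hnext using step
  let s : ℕ → List (Rect X Y) := fun n => Nat.rec [] (fun _ l => next l :: l) n
  have hs : ∀ n, history (fun k => next (s k)) n = s n := by
    intro n
    induction n with
    | zero => rfl
    | succ n ih => simp only [history, ih]; rfl
  have hcur : ∀ n, current (s n) ∉ I.carrier := by
    intro n
    induction n with
    | zero => exact htop
    | succ n ih => exact (hnext _ ih).2
  refine hσ ⟨fun n => next (s n), fun n => ?_⟩
  rw [hs]
  exact (hnext _ (hcur n)).1

/-- Player I has a winning strategy in the game for `𝒲` that starts at the rectangle `R`. -/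
def WinsFrom (𝒲 : OpenCover (X × Y)) (R : Rect X Y) : Prop :=
  ∃ σ : Strategy X Y, ¬ ∃ r : ℕ → Rect X Y, ∀ n,
    (r n).1 ∈ restrict (σ (history r n)).1 ((history r n).headD R).1 ∧
    (r n).2 ∈ restrict (σ (history r n)).2 ((history r n).headD R).2 ∧
    ∀ W ∈ 𝒲.members, ¬ ((r n).1 : Set X) ×ˢ ((r n).2 : Set Y) ⊆ (W : Set (X × Y))

/-- Separates the opening selection, stored at the end of the list, from the play that continues
from it. -/
theorem history_succ' (r : ℕ → Rect X Y) (n : ℕ) :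
    history r (n + 1) = history (fun k => r (k + 1)) n ++ [r 0] := by
  induction n with
  | zero => rfl
  | succ n ih =>
    rw [history, ih]
    rfl

theorem headD_append_singleton {α : Type*} (l : List α) (a b : α) :
    (l ++ [a]).headD b = l.headD a := by
  cases l <;> rfl

/-- Player I wins from a rectangle if some covers lead only to rectangles from which he wins. -/
theorem WinsFrom.step {𝒲 : OpenCover (X × Y)} {R : Rect X Y} (c : OpenCover X × OpenCover Y)
    (h : ∀ P ∈ restrict c.1 R.1, ∀ Q ∈ restrict c.2 R.2, WinsFrom 𝒲 (P, Q)) :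
    WinsFrom 𝒲 R := by
  classical
  have h' : ∀ S : Rect X Y, ∃ σ : Strategy X Y, S.1 ∈ restrict c.1 R.1 → S.2 ∈ restrict c.2 R.2 →
      ¬ ∃ r : ℕ → Rect X Y, ∀ n,
        (r n).1 ∈ restrict (σ (history r n)).1 ((history r n).headD S).1 ∧
        (r n).2 ∈ restrict (σ (history r n)).2 ((history r n).headD S).2 ∧
        ∀ W ∈ 𝒲.members, ¬ ((r n).1 : Set X) ×ˢ ((r n).2 : Set Y) ⊆ (W : Set (X × Y)) := by
    intro S
    by_cases hS : S.1 ∈ restrict c.1 R.1 ∧ S.2 ∈ restrict c.2 R.2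
    · obtain ⟨σ, hσ⟩ := h _ hS.1 _ hS.2
      exact ⟨σ, fun _ _ => hσ⟩
    · exact ⟨fun _ => c, fun h₁ h₂ => absurd ⟨h₁, h₂⟩ hS⟩
  choose τ hτ using h'
  -- Reversal exposes the opening selection `S`; from then on the strategy for `S` sees the history
  -- without it.
  refine ⟨fun l => match l.reverse with
    | [] => c
    | S :: t => τ S t.reverse, ?_⟩
  rintro ⟨r, hr⟩
  obtain ⟨h₁, h₂, -⟩ := hr 0
  refine hτ (r 0) h₁ h₂ ⟨fun k => r (k + 1), fun n => ?_⟩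
  have := hr (n + 1)
  simpa only [history_succ', headD_append_singleton, List.reverse_append, List.reverse_cons,
    List.reverse_nil, List.nil_append, List.singleton_append, List.reverse_reverse] using this

/-- Player II has no first move, since every selection stays inside `R`. -/
theorem WinsFrom.of_subset {𝒲 : OpenCover (X × Y)} {R : Rect X Y} {W : Opens (X × Y)}
    (hW : W ∈ 𝒲.members) (h : (R.1 : Set X) ×ˢ (R.2 : Set Y) ⊆ (W : Set (X × Y))) :
    WinsFrom 𝒲 R := by
  refine ⟨fun _ => (⟨{⊤}, fun _ => ⟨⊤, rfl, trivial⟩⟩, ⟨{⊤}, fun _ => ⟨⊤, rfl, trivial⟩⟩), ?_⟩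
  rintro ⟨r, hr⟩
  obtain ⟨⟨G, -, h₁⟩, ⟨H, -, h₂⟩, h₃⟩ := hr 0
  refine h₃ W hW (Set.Subset.trans (Set.prod_mono ?_ ?_) h)
  · rw [h₁]; exact Set.inter_subset_left
  · rw [h₂]; exact Set.inter_subset_left

/-- Player I wins from a rectangle without points. In an empty product he may play an empty
cover. -/
theorem WinsFrom.of_eq_empty {𝒲 : OpenCover (X × Y)} {R : Rect X Y}
    (h : (R.1 : Set X) ×ˢ (R.2 : Set Y) = ∅) : WinsFrom 𝒲 R := by
  -- If `𝒲` has no members, even an empty rectangle is a legal selection, so Player I must deny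
  -- Player II any piece at all.
  rcases 𝒲.members.eq_empty_or_nonempty with h𝒲 | ⟨W, hW⟩
  · have hempty : IsEmpty (X × Y) := ⟨fun z => by
      obtain ⟨W, hW, -⟩ := 𝒲.covers z
      simp [h𝒲] at hW⟩
    rcases isEmpty_prod.1 hempty with hX | hY
    · refine WinsFrom.step (⟨∅, fun x => hX.elim x⟩, ⟨{⊤}, fun _ => ⟨⊤, rfl, trivial⟩⟩) ?_
      rintro P ⟨G, hG, -⟩
      exact hG.elim
    · refine WinsFrom.step (⟨{⊤}, fun _ => ⟨⊤, rfl, trivial⟩⟩, ⟨∅, fun y => hY.elim y⟩) ?_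
      rintro P - Q ⟨G, hG, -⟩
      exact hG.elim
  · exact WinsFrom.of_subset hW (h ▸ Set.empty_subset _)

/-- In a regular space, the closure of an open set that is contained in a join is covered by
open sets with closures in the single terms. -/
theorem exists_cover_closure_subset [RegularSpace X] {S : Set (Opens X)} {U : Opens X}
    (h : closure (U : Set X) ⊆ (sSup S : Opens X)) :
    ∃ 𝒢 : OpenCover X, ∀ P ∈ restrict 𝒢 U, P = ⊥ ∨ ∃ A ∈ S, closure (P : Set X) ⊆ A := by
  -- Regularity handles the points of the closure of `U`; the complement of that closure covers the
  -- others and restricts to `⊥`.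
  refine ⟨⟨{G | U ⊓ G = ⊥ ∨ ∃ A ∈ S, closure (G : Set X) ⊆ A}, fun x => ?_⟩, ?_⟩
  · by_cases hx : x ∈ closure (U : Set X)
    · obtain ⟨A, hA, hxA⟩ := Opens.mem_sSup.1 (h hx)
      rw [← Opens.sSup_closure_subset A] at hxA
      obtain ⟨G, hG, hxG⟩ := Opens.mem_sSup.1 hxA
      exact ⟨G, Or.inr ⟨A, hA, hG⟩, hxG⟩
    · refine ⟨⟨(closure (U : Set X))ᶜ, isClosed_closure.isOpen_compl⟩, Or.inl ?_, hx⟩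
      ext z
      simpa using fun hz : z ∈ U => subset_closure (SetLike.mem_coe.2 hz)
  · rintro _ ⟨G, hG | ⟨A, hA, hGA⟩, rfl⟩
    · exact Or.inl hG
    · exact Or.inr ⟨A, hA, (closure_mono Set.inter_subset_right).trans hGA⟩

/-- The element of the localic product of the rectangles `R` such that Player I wins from each
rectangle with closure in `R`. -/
def winningElement [RegularSpace X] [RegularSpace Y] (𝒲 : OpenCover (X × Y)) :
    LocalicProduct X Y where
  carrier := {R | ∀ (U : Opens X) (V : Opens Y), closure (U : Set X) ⊆ R.1 → closure (V : Set Y) ⊆ R.2 →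
    WinsFrom 𝒲 (U, V)}
  lower' := fun _ _ hle h U V hU hV => h U V (hU.trans hle.1) (hV.trans hle.2)
  sSup_left' := fun S B h U V hU hV => by
    obtain ⟨𝒢, h𝒢⟩ := exists_cover_closure_subset hU
    refine WinsFrom.step (𝒢, ⟨{⊤}, fun _ => ⟨⊤, rfl, trivial⟩⟩) ?_
    rintro P hP _ ⟨_, rfl, rfl⟩
    rcases h𝒢 P hP with rfl | ⟨A, hA, hPA⟩
    · exact WinsFrom.of_eq_empty (by simp)
    · exact h A hA P _ hPA (by simpa using hV)
  sSup_right' := fun A T h U V hU hV => by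
    obtain ⟨ℋ, hℋ⟩ := exists_cover_closure_subset hV
    refine WinsFrom.step (⟨{⊤}, fun _ => ⟨⊤, rfl, trivial⟩⟩, ℋ) ?_
    rintro _ ⟨_, rfl, rfl⟩ Q hQ
    rcases hℋ Q hQ with rfl | ⟨B, hB, hQB⟩
    · exact WinsFrom.of_eq_empty (by simp)
    · exact h B hB _ Q (by simpa using hU) hQB

theorem exists_mem_winningElement [RegularSpace X] [RegularSpace Y] (𝒲 : OpenCover (X × Y))
    (x : X) (y : Y) : ∃ p ∈ (winningElement 𝒲).carrier, x ∈ p.1 ∧ y ∈ p.2 := by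
  obtain ⟨W, hW, hxy⟩ := 𝒲.covers (x, y)
  obtain ⟨A, B, hA, hB, hxA, hyB, hAB⟩ := isOpen_prod_iff.1 W.isOpen x y hxy
  exact ⟨(⟨A, hA⟩, ⟨B, hB⟩), fun U V hU hV => WinsFrom.of_subset hW
    ((Set.prod_mono (subset_closure.trans hU) (subset_closure.trans hV)).trans hAB), hxA, hyB⟩

/-- If Player I wins all games on a product of regular spaces, then an element of the localic
product has every rectangle that its rectangles cover. -/
theorem mem_of_playerIWins [RegularSpace X] [RegularSpace Y]
    (h : ∀ 𝒲 : OpenCover (X × Y), PlayerIWins 𝒲) (I : LocalicProduct X Y) (U : Opens X)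
    (V : Opens Y) (hUV : ∀ x ∈ U, ∀ y ∈ V, ∃ p ∈ I.carrier, x ∈ p.1 ∧ y ∈ p.2) :
    (U, V) ∈ I.carrier := by
  -- It suffices to treat `U'` and `V'` with closures in `U` and `V`: the rectangles of `I` cover
  -- the product of the closures, and sets missing `U' × V'` complete them to a cover of `X × Y`.
  rw [← Opens.sSup_closure_subset U, ← Opens.sSup_closure_subset V]
  refine I.sSup_left' _ _ fun U' hU' => I.sSup_right' _ _ fun V' hV' => ?_
  let 𝒲 : OpenCover (X × Y) :=
    { members := {W | (W : Set (X × Y)) ∩ (U' : Set X) ×ˢ (V' : Set Y) = ∅ ∨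
        ∃ p ∈ I.carrier, (W : Set (X × Y)) = (p.1 : Set X) ×ˢ (p.2 : Set Y)}
      covers := fun z => by
        by_cases hz : z ∈ closure (U' : Set X) ×ˢ closure (V' : Set Y)
        · obtain ⟨p, hp, hzp⟩ := hUV z.1 (hU' hz.1) z.2 (hV' hz.2)
          exact ⟨⟨(p.1 : Set X) ×ˢ (p.2 : Set Y), p.1.isOpen.prod p.2.isOpen⟩,
            Or.inr ⟨p, hp, rfl⟩, hzp⟩
        · refine ⟨⟨_, (isClosed_closure.prod isClosed_closure).isOpen_compl⟩, Or.inl ?_, hz⟩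
          refine Set.eq_empty_of_forall_notMem fun w hw => hw.1 ?_
          exact Set.prod_mono subset_closure subset_closure hw.2 }
  -- A rectangle inside a member of `𝒲` meets `U' × V'` in no points or within a rectangle of `I`,
  -- so it lies in the residual.
  have key := top_mem_of_playerIWins (h 𝒲) (FrameCoprod.rectResidual (U', V') I) (by
    rintro R W (hW | ⟨p, hp, hW⟩) hRW
    · refine FrameCoprod.mem_of_prod_subset I (FrameCoprod.bot_left_mem I ⊥) ?_
      rintro w ⟨hw₁, hw₂⟩
      have : w ∈ (W : Set (X × Y)) ∩ (U' : Set X) ×ˢ (V' : Set Y) :=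
        ⟨hRW ⟨hw₁.1, hw₂.1⟩, hw₁.2, hw₂.2⟩
      rw [hW] at this
      exact this.elim
    · refine FrameCoprod.mem_of_prod_subset I hp ?_
      rw [← hW]
      exact (Set.prod_mono Set.inter_subset_left Set.inter_subset_left).trans hRW)
  have key' : ((⊤, ⊤) : Opens X × Opens Y) ⊓ (U', V') ∈ I.carrier := key
  rwa [show ((⊤, ⊤) : Opens X × Opens Y) ⊓ (U', V') = (U', V') from top_inf_eq _] at key'

end RectGame

theorem theorem6 {X : Type u} {Y : Type v} [TopologicalSpace X] [TopologicalSpace Y]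
    [ParacompactSpace X] [T2Space X] [ParacompactSpace Y] [T2Space Y] :
    IsSpatialLocale (LocalicProduct X Y) ↔
      ∀ 𝒲 : OpenCover (X × Y), RectGame.PlayerIWins 𝒲 := by
  constructor
  · intro hsp 𝒲
    have htop : RectGame.winningElement 𝒲 = ⊤ := by
      by_contra hne
      obtain ⟨φ, hφ⟩ := hsp _ _ hne
      refine hφ (propext ⟨fun _ => by rw [map_top]; trivial, fun _ => ?_⟩)
      exact FrameCoprod.map_of_forall_mem φ (RectGame.exists_mem_winningElement 𝒲)
    have hmem : ((⊤, ⊤) : Opens X × Opens Y) ∈ (RectGame.winningElement 𝒲).carrier := by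
      rw [htop]; exact Set.mem_univ _
    -- The game from `(⊤, ⊤)` is the original game by definition.
    exact hmem ⊤ ⊤ (Set.subset_univ _) (Set.subset_univ _)
  · intro h I J hIJ
    by_contra! hφ
    have le : ∀ I J : LocalicProduct X Y, (∀ φ : FrameHom (LocalicProduct X Y) Prop, φ I = φ J) →
        I ≤ J := by
      rintro I J hφ ⟨U, V⟩ hUV
      refine RectGame.mem_of_playerIWins h J U V fun x hx y hy => ?_
      obtain ⟨φ, hpt⟩ := FrameCoprod.exists_point x y
      exact (hpt J).1 (hφ φ ▸ (hpt I).2 ⟨(U, V), hUV, hx, hy⟩)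
    exact hIJ (le_antisymm (le I J hφ) (le J I fun φ => (hφ φ).symm))
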